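/- **Theorem (Statistical convergence).** There is an absolute constant $C_1>0$ and, for every integer $K\ge 1$, a constant $C_2>0$ depending only on $K$, such that the following holds for all $d_1,\dots,d_K\ge 1$, all $R\ge 1$ and all $\alpha>0$. Let $f\colon\mathbb R\to[0,1]$ be strictly increasing and strictly log-concave, twice differentiable on $\mathbb R\setminus\{0\}$, symmetric in the sense that $f(-\theta)=1-f(\theta)$ for all $\theta$ (so that $f'$ is even), with $f'$ unimodal with mode $0$. Put $$L_\alpha=\sup_{|\theta|\le\alpha}\frac{f'(\theta)}{f(\theta)(1-f(\theta))},\qquad \gamma_\alpha=\inf_{|\theta|\le\alpha,\ \theta\ne0}\Big\{\frac{f'(\theta)^2}{f(\theta)^2}-\frac{f''(\theta)}{f(\theta)}\Big\}.$$ Let $\mathcal D$ be a compact set of tensors $\Theta\in\mathbb R^{d_1\times\cdots\times d_K}$ of CP rank exactly $R$ with $\max_{i_1,\dots,i_K}|\theta_{i_1,\dots,i_K}|\le\alpha$, and let $\Theta_{\mathrm{true}}\in\mathcal D$. Let $\mathcal Y\in\{0,1\}^{d_1\times\cdots\times d_K}$ be a random tensor with independent entries and $\mathbb P(y_{i_1,\dots,i_K}=1)=f(\theta_{\mathrm{true},i_1,\dots,i_K})$,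 and let $$\mathcal L_{\mathcal Y}(\Theta)=\sum_{i_1,\dots,i_K}\Big[\mathbf 1_{\{y_{i_1,\dots,i_K}=1\}}\log f(\theta_{i_1,\dots,i_K})+\mathbf 1_{\{y_{i_1,\dots,i_K}=0\}}\log\{1-f(\theta_{i_1,\dots,i_K})\}\Big].$$ Then the constrained maximum likelihood estimate $\hat\Theta_{\mathrm{MLE}}\in\arg\max_{\Theta\in\mathcal D}\mathcal L_{\mathcal Y}(\Theta)$ exists, and with probability at least $1-\exp(-C_1\log K\sum_k d_k)$ every such $\hat\Theta=\hat\Theta_{\mathrm{MLE}}$ satisfies $$\frac{1}{\sqrt{\prod_k d_k}}\,\|\hat\Theta-\Theta_{\mathrm{true}}\|_F\le\min\left(2\alpha,\ \frac{C_2L_\alpha}{\gamma_\alpha}\sqrt{\frac{R^{K-1}\sum_k d_k}{\prod_k d_k}}\right),$$ where the quotient is read as $+\infty$ if $\gamma_\alpha=0$. With probability at least $1-\exp(-C_1\log K\sum_k d_k)$, the same bound holds simultaneously for all $\hat\Theta\in\mathcal D$ with $\mathcal L_{\mathcal Y}(\hat\Theta)\ge\mathcal L_{\mathcal Y}(\Theta_{\mathrm{true}})$.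 -/

import Mathlib

open MeasureTheory ProbabilityTheory
open scoped ENNReal

namespace BinaryTensor

/-- Multi-indices `(i₁, …, i_K)` of order-`K` tensors of dimension `(d₁, …, d_K)`. -/
abbrev Index {K : ℕ} (d : Fin K → ℕ) : Type := (k : Fin K) → Fin (d k)

/-- Real tensors of dimension `(d₁, …, d_K)`. -/
abbrev Tensor {K : ℕ} (d : Fin K → ℕ) : Type := Index d → ℝ

/-- Binary tensors of dimension `(d₁, …, d_K)`, with entries in `{0, 1}`. -/
abbrev BinTensor {K : ℕ} (d : Fin K → ℕ) : Type := Index d → Fin 2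

noncomputable section

variable {K : ℕ} {d : Fin K → ℕ}

/-- The outer product of the vectors `a k ∈ ℝ^(d k)`. -/
def outer (a : (k : Fin K) → Fin (d k) → ℝ) : Tensor d :=
  fun i => ∏ k, a k (i k)

/-- The (CP) rank: the least number of outer products that sum to `Θ`. -/
def cpRank (Θ : Tensor d) : ℕ :=
  sInf {R : ℕ | ∃ a : Fin R → (k : Fin K) → Fin (d k) → ℝ, Θ = ∑ r, outer (a r)}

/-- The Frobenius norm. -/
def frobNorm (Θ : Tensor d) : ℝ := √(∑ i, Θ i ^ 2)

/-- The maximum norm. -/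
def maxNorm (Θ : Tensor d) : ℝ := ⨆ i, |Θ i|

/-- The set of tensors of rank exactly `R` and maximum norm at most `α`. -/
def paramSet (d : Fin K → ℕ) (R : ℕ) (α : ℝ) : Set (Tensor d) :=
  {Θ | cpRank Θ = R ∧ maxNorm Θ ≤ α}

/-- The assumptions on the link function. Values in `[0, 1]` and strict monotonicity force
`0 < f < 1`. The field `symm` makes `f'` an even function. -/
structure IsLink (f : ℝ → ℝ) : Prop where
  mem_Icc : ∀ θ, f θ ∈ Set.Icc (0 : ℝ) 1
  strictMono : StrictMono f
  differentiableAt : ∀ θ, θ ≠ 0 → DifferentiableAt ℝ f θ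
  differentiableAt_deriv : ∀ θ, θ ≠ 0 → DifferentiableAt ℝ (deriv f) θ
  strictLogConcave : StrictConcaveOn ℝ Set.univ (fun θ => Real.log (f θ))
  symm : ∀ θ, f (-θ) = 1 - f θ
  unimodal_left : MonotoneOn (deriv f) (Set.Iic 0)
  unimodal_right : AntitoneOn (deriv f) (Set.Ici 0)

/-- `L_α = sup_{|θ| ≤ α} f'(θ) / (f(θ) (1 - f(θ)))`. -/
def steepness (f : ℝ → ℝ) (α : ℝ) : ℝ :=
  sSup ((fun θ => deriv f θ / (f θ * (1 - f θ))) '' {θ : ℝ | |θ| ≤ α})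

/-- `γ_α = inf_{|θ| ≤ α} (f'(θ)² / f(θ)² - f''(θ) / f(θ))`, over the points `θ ≠ 0`, at which
`f` is assumed to be twice differentiable. -/
def convexity (f : ℝ → ℝ) (α : ℝ) : ℝ :=
  sInf ((fun θ => deriv f θ ^ 2 / f θ ^ 2 - deriv (deriv f) θ / f θ) ''
    {θ : ℝ | |θ| ≤ α ∧ θ ≠ 0})

/-- The log-likelihood of `Θ` given the binary tensor `y`. -/
def logLik (f : ℝ → ℝ) (y : BinTensor d) (Θ : Tensor d) : ℝ :=
  ∑ i, ((if y i = 1 then Real.log (f (Θ i)) else 0) +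
    (if y i = 0 then Real.log (1 - f (Θ i)) else 0))

/-- `Θhat` is a maximum likelihood estimate over the search space `D`. -/
def IsMLE (f : ℝ → ℝ) (D : Set (Tensor d)) (y : BinTensor d) (Θhat : Tensor d) : Prop :=
  Θhat ∈ D ∧ ∀ Θ ∈ D, logLik f y Θ ≤ logLik f y Θhat

/-- `Θhat` lies in `D` and its likelihood is at least that of `Θtrue`. -/
def InLevelSet (f : ℝ → ℝ) (D : Set (Tensor d)) (Θtrue : Tensor d) (y : BinTensor d)
    (Θhat : Tensor d) : Prop :=
  Θhat ∈ D ∧ logLik f y Θtrue ≤ logLik f y Θhat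

/-- The random binary tensor `Y` has independent Bernoulli entries with success probabilities
`f (Θ i)`. -/
structure IsBernoulliModel {Ω : Type*} [MeasurableSpace Ω] (f : ℝ → ℝ) (Θ : Tensor d)
    (μ : Measure Ω) (Y : Ω → BinTensor d) : Prop where
  measurable : ∀ i, Measurable (fun ω => Y ω i)
  indep : iIndepFun (fun i ω => Y ω i) μ
  prob : ∀ i, μ {ω | Y ω i = 1} = ENNReal.ofReal (f (Θ i))

/-- The normalized Frobenius loss. -/
def loss (Θhat Θtrue : Tensor d) : ℝ :=
  1 / √(∏ k, (d k : ℝ)) * frobNorm (Θhat - Θtrue)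

/-- `min (2α, C₂ L_α / γ_α · √(R^(K-1) ∑ d_k / ∏ d_k))`. It is valued in `[0, ∞]`, where the
quotient is `∞` if `γ_α = 0`. -/
def errorBound (d : Fin K → ℕ) (f : ℝ → ℝ) (R : ℕ) (α C₂ : ℝ) : ℝ≥0∞ :=
  min (ENNReal.ofReal (2 * α))
    (ENNReal.ofReal (C₂ * steepness f α) / ENNReal.ofReal (convexity f α) *
      ENNReal.ofReal √((R : ℝ) ^ (K - 1) * (∑ k, (d k : ℝ)) / ∏ k, (d k : ℝ)))

end

end BinaryTensor

namespace BinaryTensor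

/-! ### Test vectors for the Euclidean norm -/

/-! Let `S` be the score at the true tensor, `Δ` the estimation error and `γ` the convexity
constant. If `γ > 0`, the log-likelihood lies below its tangent at the truth minus `γ/2 * ‖Δ‖²`
(`logLik_le_quadratic`), so a tensor of at least the true likelihood satisfies `γ/2 * ‖Δ‖² ≤ ⟨S,
Δ⟩`.

As `Δ` is a sum of `2R` outer products, `⟨S, Δ⟩` is at most the spectral norm of `S` times
`√((2R)^(K-1)) * ‖Δ‖` (`sum_mul_le_of_sum_outer`); divide by `‖Δ‖`. The spectral norm is handled by
Hoeffding's inequality and a union bound over at most `5^(∑ d_k)` outer products of test vectors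
(`sum_mul_outer_le_of_testVectors`, `measureReal_exists_score_ge_le`). The bound `2α` is entrywise.
-/

lemma exists_finset_forall_norm_sub_lt (E : Type*) [NormedAddCommGroup E] [NormedSpace ℝ E]
    [FiniteDimensional ℝ E] :
    ∃ s : Finset E, s.card ≤ 5 ^ Module.finrank ℝ E ∧ (∀ c ∈ s, ‖c‖ ≤ 2) ∧
      ∀ x : E, ‖x‖ ≤ 2 → ∃ c ∈ s, ‖x - c‖ < 1 := by
  classical
  by_contra! hcon
  -- If no net existed, a 1-separated set in the ball could be enlarged forever, against the packing
  -- bound.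
  have key : ∀ k : ℕ, ∃ s : Finset E, s.card = k ∧ (∀ c ∈ s, ‖c‖ ≤ 2) ∧
      ∀ c ∈ s, ∀ e ∈ s, c ≠ e → 1 ≤ ‖c - e‖ := by
    intro k
    induction k with
    | zero => exact ⟨∅, by simp⟩
    | succ k ih =>
      obtain ⟨s, hk, hs, hsep⟩ := ih
      obtain ⟨x, hx, hxs⟩ := hcon s (Besicovitch.card_le_of_separated s hs hsep) hs
      refine ⟨insert x s, ?_, ?_, ?_⟩
      · rw [Finset.card_insert_of_notMem, hk]
        intro hmem
        have := hxs x hmem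
        simp at this
        linarith
      · intro c hc
        rcases Finset.mem_insert.1 hc with rfl | hc
        exacts [hx, hs c hc]
      · intro c hc e he hne
        rcases Finset.mem_insert.1 hc with rfl | hc'
        · exact hxs e ((Finset.mem_insert.1 he).resolve_left hne.symm)
        · rcases Finset.mem_insert.1 he with rfl | he'
          · rw [norm_sub_rev]; exact hxs c hc'
          · exact hsep c hc' e he' hne
  obtain ⟨s, hk, hs, hsep⟩ := key (5 ^ Module.finrank ℝ E + 1)
  have := Besicovitch.card_le_of_separated s hs hsep
  omega

/-- At most `5 ^ n` vectors of norm at most `2` suffice to test the Euclidean norm on `ℝ^n`. -/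
lemma exists_testVectors (n : ℕ) :
    ∃ s : Finset (Fin n → ℝ), s.card ≤ 5 ^ n ∧ (∀ c ∈ s, ∑ j, c j ^ 2 ≤ 4) ∧
      ∀ (w : Fin n → ℝ) (m : ℝ), (∀ c ∈ s, ∑ j, c j * w j ≤ m) → √(∑ j, w j ^ 2) ≤ m := by
  classical
  obtain ⟨s, hcard, hs, hcov⟩ := exists_finset_forall_norm_sub_lt (EuclideanSpace ℝ (Fin n))
  refine ⟨s.image (fun c => c.ofLp), ?_, ?_, ?_⟩
  · refine Finset.card_image_le.trans ?_
    simpa using hcard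
  · intro c hc
    obtain ⟨c, hc', rfl⟩ := Finset.mem_image.1 hc
    have h := hs c hc'
    rw [← EuclideanSpace.real_norm_sq_eq]
    nlinarith [norm_nonneg c]
  · intro w m h
    set v : EuclideanSpace ℝ (Fin n) := WithLp.toLp 2 w with hv
    have hnorm : √(∑ j, w j ^ 2) = ‖v‖ := by
      rw [EuclideanSpace.norm_eq]; simp [hv]
    rw [hnorm]
    -- Radius 2 and mesh 1 give `⟨c, v⟩ ≥ 2‖v‖ - ‖v‖`, so testing loses no constant. For `v = 0` the
    -- point is `0`.
    obtain ⟨c, hc, hlt⟩ := hcov ((2 / ‖v‖) • v) (by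
      rw [norm_smul, norm_div, norm_norm]
      rcases eq_or_ne ‖v‖ 0 with h0 | h0
      · simp [h0]
      · rw [div_mul_cancel₀ _ h0]; simp)
    have h1 : inner ℝ c v ≤ m := by
      have := h c.ofLp (Finset.mem_image_of_mem _ hc)
      simpa [PiLp.inner_apply, hv, mul_comm] using this
    have h2 : inner ℝ ((2 / ‖v‖) • v) v = 2 * ‖v‖ := by
      rw [real_inner_smul_left, real_inner_self_eq_norm_sq]
      rcases eq_or_ne ‖v‖ 0 with h0 | h0
      · simp [h0]
      · field_simp
    have h3 : inner ℝ ((2 / ‖v‖) • v - c) v ≤ ‖v‖ :=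
      (real_inner_le_norm _ _).trans (mul_le_of_le_one_left (norm_nonneg _) hlt.le)
    rw [inner_sub_left, h2] at h3
    linarith

/-- Coordinates with respect to an orthonormal basis of the span of `N` vectors. -/
lemma exists_orthonormal_frame {N n : ℕ} (a : Fin N → Fin n → ℝ) :
    ∃ m ≤ N, ∃ b : Fin m → Fin n → ℝ, (∀ p, ∑ j, b p j ^ 2 = 1) ∧
      ∀ (c : Fin N → ℝ) (y : Fin n → ℝ),
        ∑ j, y j * ∑ r, c r * a r j =
          ∑ p, (∑ j, b p j * y j) * ∑ j, b p j * ∑ r, c r * a r j := by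
  let A : Fin N → EuclideanSpace ℝ (Fin n) := fun r => WithLp.toLp 2 (a r)
  let W := Submodule.span ℝ (Set.range A)
  have hW : Module.finrank ℝ W ≤ N :=
    (finrank_range_le_card (R := ℝ) A).trans_eq (Fintype.card_fin N)
  let b := stdOrthonormalBasis ℝ W
  refine ⟨_, hW, fun p => (b p : EuclideanSpace ℝ (Fin n)).ofLp, fun p => ?_, fun c y => ?_⟩
  · have h := b.orthonormal.1 p
    rw [← EuclideanSpace.real_norm_sq_eq, ← Submodule.coe_norm, h, one_pow]
  · have hx : (∑ r, c r • A r) ∈ W :=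
      Submodule.sum_mem _ fun r _ => Submodule.smul_mem _ _ (Submodule.subset_span ⟨r, rfl⟩)
    have hcoord : ∀ j, (∑ r, c r • A r).ofLp j = ∑ r, c r * a r j := fun j => by simp [A]
    simp only [← hcoord]
    generalize (∑ r, c r • A r) = x at hx
    have h := congrArg (fun z : W => inner ℝ (z : EuclideanSpace ℝ (Fin n)) (WithLp.toLp 2 y))
      (b.sum_repr' ⟨x, hx⟩)
    simp only [Submodule.coe_sum, Submodule.coe_smul, sum_inner, real_inner_smul_left,
      Submodule.coe_inner] at h
    simp only [PiLp.inner_apply, RCLike.inner_apply, conj_trivial] at h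
    rw [← h]
    refine Finset.sum_congr rfl fun p _ => ?_
    rw [mul_comm]
    congr 1 <;> exact Finset.sum_congr rfl fun j _ => mul_comm _ _

/-! ### Contraction of the first mode -/

section Contraction

variable {K : ℕ} {d : Fin (K + 1) → ℕ}

lemma sum_index_succ (F : Index d → ℝ) :
    ∑ i, F i = ∑ j : Fin (d 0), ∑ i : Index (fun k => d k.succ), F (Fin.cons j i) := by
  rw [← Fintype.sum_prod_type']
  exact (Fintype.sum_equiv (Fin.consEquiv (fun k => Fin (d k))) _ _ (fun _ => rfl)).symm

lemma outer_cons_apply (u : (k : Fin (K + 1)) → Fin (d k) → ℝ) (j : Fin (d 0))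
    (i : Index (fun k => d k.succ)) :
    outer u (Fin.cons j i) = u 0 j * outer (d := fun k => d k.succ) (fun k => u k.succ) i := by
  simp [outer, Fin.prod_univ_succ]

lemma sum_mul_outer_succ (S : Tensor d) (u : (k : Fin (K + 1)) → Fin (d k) → ℝ) :
    ∑ i, S i * outer u i = ∑ j, u 0 j * ∑ i : Index (fun k => d k.succ),
      S (Fin.cons j i) * outer (d := fun k => d k.succ) (fun k => u k.succ) i := by
  rw [sum_index_succ]
  refine Finset.sum_congr rfl fun j _ => ?_
  rw [Finset.mul_sum]
  refine Finset.sum_congr rfl fun i _ => ?_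
  rw [outer_cons_apply]; ring

/-- With the previous lemma, this allows mode 0 to be contracted either first or last. -/
lemma sum_mul_outer_succ' (S : Tensor d) (u : (k : Fin (K + 1)) → Fin (d k) → ℝ) :
    ∑ i, S i * outer u i = ∑ i : Index (fun k => d k.succ), (∑ j, u 0 j * S (Fin.cons j i)) *
      outer (d := fun k => d k.succ) (fun k => u k.succ) i := by
  rw [sum_mul_outer_succ]
  simp only [Finset.mul_sum, Finset.sum_mul]
  rw [Finset.sum_comm]
  refine Finset.sum_congr rfl fun i _ => Finset.sum_congr rfl fun j _ => ?_
  ring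

end Contraction

/-- The spectral norm of a tensor is controlled by its values on test vectors. -/
theorem sum_mul_outer_le_of_testVectors {K : ℕ} (d : Fin K → ℕ)
    (s : (k : Fin K) → Finset (Fin (d k) → ℝ))
    (hs : ∀ (k : Fin K) (w : Fin (d k) → ℝ) (m : ℝ),
      (∀ c ∈ s k, ∑ j, c j * w j ≤ m) → √(∑ j, w j ^ 2) ≤ m)
    (S : Tensor d) (M : ℝ)
    (h : ∀ v : (k : Fin K) → Fin (d k) → ℝ, (∀ k, v k ∈ s k) → ∑ i, S i * outer v i ≤ M)
    (u : (k : Fin K) → Fin (d k) → ℝ) :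
    ∑ i, S i * outer u i ≤ M * ∏ k, √(∑ j, u k j ^ 2) := by
  induction K generalizing M with
  | zero => simpa using h u fun k => k.elim0
  | succ K ih =>
    rw [sum_mul_outer_succ', Fin.prod_univ_succ, ← mul_assoc]
    -- Induct on `S` contracted with `u 0`, with `M * ‖u 0‖` in place of `M`. For test vectors `v`
    -- in the other modes, contracting mode 0 last leaves a vector `w`, to which `hs 0` and
    -- Cauchy–Schwarz apply.
    refine ih (fun k => d k.succ) (fun k => s k.succ) (fun k => hs k.succ) _ _ (fun v hv => ?_) _
    set w : Fin (d 0) → ℝ := fun j => ∑ i : Index (fun k => d k.succ),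
      S (Fin.cons j i) * outer (d := fun k => d k.succ) v i with hw
    have hwM : √(∑ j, w j ^ 2) ≤ M := by
      refine hs 0 w M fun c hc => ?_
      have := h (Fin.cons c v) (Fin.cases hc hv)
      rw [sum_mul_outer_succ] at this
      simpa [hw] using this
    have hsum : ∑ i : Index (fun k => d k.succ), (∑ j, u 0 j * S (Fin.cons j i)) *
        outer (d := fun k => d k.succ) v i = ∑ j, u 0 j * w j := by
      have h1 := sum_mul_outer_succ S (Fin.cons (u 0) v)
      rw [sum_mul_outer_succ'] at h1
      simpa [hw] using h1
    rw [hsum]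
    refine (Real.sum_mul_le_sqrt_mul_sqrt _ _ _).trans ?_
    rw [mul_comm]
    exact mul_le_mul_of_nonneg_right hwM (Real.sqrt_nonneg _)

/-- Duality between the spectral norm of `S` and the nuclear norm of a sum of `N` outer
products, the latter being at most `√(N ^ K)` times the Frobenius norm for order `K + 1`. -/
theorem sum_mul_le_of_sum_outer {K : ℕ} (d : Fin (K + 1) → ℕ) (S : Tensor d) (M : ℝ) (hM : 0 ≤ M)
    (h : ∀ u : (k : Fin (K + 1)) → Fin (d k) → ℝ,
      ∑ i, S i * outer u i ≤ M * ∏ k, √(∑ j, u k j ^ 2))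
    {N : ℕ} (c : Fin N → ℝ) (a : Fin N → (k : Fin (K + 1)) → Fin (d k) → ℝ) (Δ : Tensor d)
    (hΔ : ∀ i, Δ i = ∑ r, c r * outer (a r) i) :
    ∑ i, S i * Δ i ≤ M * √((N : ℝ) ^ K) * √(∑ i, Δ i ^ 2) := by
  induction K generalizing N with
  | zero =>
    -- In order one, `Δ` is itself a vector to test against.
    have h1 := h (Fin.cons (fun j => Δ (Fin.cons j finZeroElim)) finZeroElim)
    rw [sum_mul_outer_succ] at h1
    rw [sum_index_succ, sum_index_succ (fun i => Δ i ^ 2)]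
    have e : ∀ x : Index (fun k : Fin 0 => d k.succ), x = finZeroElim := fun x =>
      funext fun k => k.elim0
    simpa [outer, Finset.univ_unique, e, mul_comm] using h1
  | succ K ih =>
    -- Expand mode 0 in an orthonormal frame of the span of the first factors. Each of the `m ≤ N`
    -- slices of `Δ` is again a combination of `N` outer products, and contracting `S` with a unit
    -- vector keeps the bound `M`. Summing the slice norms by Cauchy–Schwarz costs `√m ≤ √N`.
    obtain ⟨m, hm, b, hb1, hb⟩ := exists_orthonormal_frame (fun r => a r 0)
    have hfib : ∀ (i : Index (fun k => d k.succ)) j, Δ (Fin.cons j i) =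
        ∑ r, (c r * outer (d := fun k => d k.succ) (fun k => a r k.succ) i) * a r 0 j := by
      intro i j
      rw [hΔ]
      refine Finset.sum_congr rfl fun r _ => ?_
      rw [outer_cons_apply]; ring
    have hexp : ∀ (T : Tensor d), ∑ i, T i * Δ i = ∑ p, ∑ i : Index (fun k => d k.succ),
        (∑ j, b p j * T (Fin.cons j i)) * ∑ j, b p j * Δ (Fin.cons j i) := by
      intro T
      rw [sum_index_succ, Finset.sum_comm, Finset.sum_comm (s := (Finset.univ : Finset (Fin m)))]
      refine Finset.sum_congr rfl fun i _ => ?_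
      simp only [hfib]
      exact hb _ (fun j => T (Fin.cons j i))
    set Δ' : Fin m → Tensor (fun k => d k.succ) := fun p i => ∑ j, b p j * Δ (Fin.cons j i) with hΔ'
    have hstep : ∀ p, ∑ i : Index (fun k => d k.succ), (∑ j, b p j * S (Fin.cons j i)) * Δ' p i ≤
        M * √((N : ℝ) ^ K) * √(∑ i, Δ' p i ^ 2) := by
      intro p
      refine ih (fun k => d k.succ) _ (fun u => ?_)
        (fun r => c r * ∑ j, b p j * a r 0 j) (fun r k => a r k.succ) (Δ' p) (fun i => ?_)
      · have := h (Fin.cons (b p) u)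
        rw [sum_mul_outer_succ', Fin.prod_univ_succ] at this
        simpa [hb1 p] using this
      · simp only [hΔ', hfib, Finset.mul_sum, Finset.sum_mul]
        rw [Finset.sum_comm]
        refine Finset.sum_congr rfl fun r _ => Finset.sum_congr rfl fun j _ => ?_
        ring
    have hsq : ∑ i, Δ i ^ 2 = ∑ p, ∑ i, Δ' p i ^ 2 := by
      simp only [sq]
      exact hexp Δ
    rw [hexp S]
    refine (Finset.sum_le_sum fun p _ => hstep p).trans ?_
    rw [← Finset.mul_sum, mul_assoc, mul_assoc]
    refine mul_le_mul_of_nonneg_left ?_ hM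
    rw [pow_succ, Real.sqrt_mul (by positivity), mul_assoc]
    refine mul_le_mul_of_nonneg_left ?_ (Real.sqrt_nonneg _)
    have hcs := Real.sum_mul_le_sqrt_mul_sqrt Finset.univ (fun _ : Fin m => (1 : ℝ))
      (fun p => √(∑ i, Δ' p i ^ 2))
    have hn : ∀ p, 0 ≤ ∑ i, Δ' p i ^ 2 := fun p => Finset.sum_nonneg fun i _ => sq_nonneg _
    simp only [one_mul, one_pow, Finset.sum_const, Finset.card_univ, Fintype.card_fin,
      nsmul_eq_mul, mul_one, Real.sq_sqrt (hn _)] at hcs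
    rw [← hsq] at hcs
    refine hcs.trans ?_
    gcongr

/-! ### The link function -/

namespace IsLink

variable {f : ℝ → ℝ}

lemma pos (hf : IsLink f) (θ : ℝ) : 0 < f θ :=
  (hf.mem_Icc (θ - 1)).1.trans_lt (hf.strictMono (by linarith))

lemma lt_one (hf : IsLink f) (θ : ℝ) : f θ < 1 :=
  (hf.strictMono (show θ < θ + 1 by linarith)).trans_le (hf.mem_Icc (θ + 1)).2

/-- The mean value theorem gives a positive derivative left of `0`, and unimodality carries it to
`0`. Since `deriv` defaults to `0`, this also yields differentiability at `0`. -/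
lemma deriv_zero_pos (hf : IsLink f) : 0 < deriv f 0 := by
  obtain ⟨c, hc, hcd⟩ := exists_deriv_eq_slope f (show (-2 : ℝ) < -1 by norm_num)
    (fun x hx => (hf.differentiableAt x (by linarith [hx.2])).continuousAt.continuousWithinAt)
    (fun x hx => (hf.differentiableAt x (by linarith [hx.2])).differentiableWithinAt)
  have h1 : deriv f c ≤ deriv f 0 :=
    hf.unimodal_left (Set.mem_Iic.2 (by linarith [hc.2])) (Set.mem_Iic.2 le_rfl) (by linarith [hc.2])
  have h2 : f (-2) < f (-1) := hf.strictMono (by norm_num)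
  have h3 : 0 < deriv f c := by
    rw [hcd]
    exact div_pos (by linarith) (by norm_num)
  linarith

lemma differentiable (hf : IsLink f) : Differentiable ℝ f := by
  intro θ
  rcases eq_or_ne θ 0 with rfl | h
  · exact differentiableAt_of_deriv_ne_zero hf.deriv_zero_pos.ne'
  · exact hf.differentiableAt θ h

lemma deriv_nonneg (hf : IsLink f) (θ : ℝ) : 0 ≤ deriv f θ :=
  hf.strictMono.monotone.deriv_nonneg

lemma deriv_neg (hf : IsLink f) (θ : ℝ) : deriv f (-θ) = deriv f θ := by
  have h : deriv (fun x => f (-x)) θ = deriv (fun x => 1 - f x) θ := by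
    simp only [hf.symm]
  rw [deriv_comp_neg, deriv_const_sub] at h
  linarith

lemma deriv_le (hf : IsLink f) (θ : ℝ) : deriv f θ ≤ deriv f 0 := by
  rcases le_total θ 0 with h | h
  · exact hf.unimodal_left h (Set.mem_Iic.2 le_rfl) h
  · exact hf.unimodal_right (Set.mem_Ici.2 le_rfl) h h

lemma bddAbove_steepness (hf : IsLink f) (α : ℝ) :
    BddAbove ((fun θ => deriv f θ / (f θ * (1 - f θ))) '' {θ : ℝ | |θ| ≤ α}) := by
  refine ⟨deriv f 0 / ((1 - f α) * (1 - f α)), ?_⟩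
  rintro _ ⟨θ, hθ, rfl⟩
  obtain ⟨h1, h2⟩ := abs_le.1 (show |θ| ≤ α from hθ)
  have h3 : 1 - f α ≤ f θ := by rw [← hf.symm]; exact hf.strictMono.monotone h1
  have h4 : f θ ≤ f α := hf.strictMono.monotone h2
  have h5 := hf.lt_one α
  have h6 : 0 < 1 - f α := by linarith
  exact div_le_div₀ hf.deriv_zero_pos.le (hf.deriv_le θ) (mul_pos h6 h6)
    (mul_le_mul h3 (by linarith) h6.le (hf.pos θ).le)

lemma le_steepness (hf : IsLink f) {α θ : ℝ} (hθ : |θ| ≤ α) :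
    deriv f θ / (f θ * (1 - f θ)) ≤ steepness f α :=
  le_csSup (hf.bddAbove_steepness α) ⟨θ, hθ, rfl⟩

lemma steepness_pos (hf : IsLink f) {α : ℝ} (hα : 0 < α) : 0 < steepness f α :=
  (div_pos hf.deriv_zero_pos (mul_pos (hf.pos 0) (by linarith [hf.lt_one 0]))).trans_le
    (hf.le_steepness (by simpa using hα.le))

lemma hasDerivAt_log (hf : IsLink f) (θ : ℝ) :
    HasDerivAt (fun x => Real.log (f x)) (deriv f θ / f θ) θ :=
  (hf.differentiable θ).hasDerivAt.log (hf.pos θ).ne'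

/-- Quadratic upper bound for `log f` on `[-α, α]`, with modulus `γ_α`. -/
theorem log_le_quadratic (hf : IsLink f) {α : ℝ} (hα : 0 < α) (hγ : 0 < convexity f α) {a b : ℝ}
    (ha : |a| ≤ α) (hb : |b| ≤ α) :
    Real.log (f b) ≤ Real.log (f a) + deriv f a / f a * (b - a) -
      convexity f α / 2 * (b - a) ^ 2 := by
  set γ := convexity f α with hγdef
  have hbdd : BddBelow ((fun θ => deriv f θ ^ 2 / f θ ^ 2 - deriv (deriv f) θ / f θ) ''
      {θ : ℝ | |θ| ≤ α ∧ θ ≠ 0}) := by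
    -- `sInf` of a set unbounded below is `0`, which `hγ` excludes.
    by_contra hcon
    have h := Real.sInf_of_not_bddBelow hcon
    rw [hγdef, convexity, h] at hγ
    exact lt_irrefl _ hγ
  set h : ℝ → ℝ := fun x => Real.log (f x) + γ / 2 * x ^ 2 with hh
  have hd : ∀ x, HasDerivAt h (deriv f x / f x + γ * x) x := by
    intro x
    refine ((hf.hasDerivAt_log x).add (((hasDerivAt_pow 2 x)).const_mul (γ / 2))).congr_deriv ?_
    norm_num
    ring
  have hdiff : Differentiable ℝ h := fun x => (hd x).differentiableAt
  have hderiv : deriv h = fun x => deriv f x / f x + γ * x := funext fun x => (hd x).deriv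
  have hd2 : ∀ x, x ≠ 0 → HasDerivAt (deriv h)
      ((deriv (deriv f) x * f x - deriv f x * deriv f x) / f x ^ 2 + γ) x := by
    intro x hx
    rw [hderiv]
    refine (((hf.differentiableAt_deriv x hx).hasDerivAt.div (hf.differentiable x).hasDerivAt
      (hf.pos x).ne').add ((hasDerivAt_id x).const_mul γ)).congr_deriv ?_
    simp
  have hd2le : ∀ x, |x| ≤ α → x ≠ 0 → deriv (deriv h) x ≤ 0 := by
    intro x hx hx0
    rw [(hd2 x hx0).deriv]
    have h1 : γ ≤ deriv f x ^ 2 / f x ^ 2 - deriv (deriv f) x / f x :=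
      csInf_le hbdd ⟨x, ⟨hx, hx0⟩, rfl⟩
    have h2 : (deriv (deriv f) x * f x - deriv f x * deriv f x) / f x ^ 2 =
        -(deriv f x ^ 2 / f x ^ 2 - deriv (deriv f) x / f x) := by
      have := (hf.pos x).ne'
      field_simp
      ring
    rw [h2]; linarith
  -- The second derivative may fail to exist at `0`: `h'` is shown antitone on each closed half, and
  -- the halves are glued at `0`.
  have hanti : ∀ l r : ℝ, (∀ x ∈ Set.Ioo l r, |x| ≤ α ∧ x ≠ 0) →
      AntitoneOn (deriv h) (Set.Icc l r) := by
    intro l r hlr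
    have hconc : ConcaveOn ℝ (Set.Icc l r) h := by
      refine concaveOn_of_deriv2_nonpos (convex_Icc l r) hdiff.continuous.continuousOn
        hdiff.differentiableOn ?_ ?_
      · rw [interior_Icc]
        exact fun x hx => (hd2 x (hlr x hx).2).differentiableAt.differentiableWithinAt
      · rw [interior_Icc]
        exact fun x hx => hd2le x (hlr x hx).1 (hlr x hx).2
    exact hconc.antitoneOn_deriv fun x _ => hdiff x
  have hIcc : AntitoneOn (deriv h) (Set.Icc (-α) α) := by
    rw [← Set.Icc_union_Icc_eq_Icc (show -α ≤ 0 by linarith) hα.le]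
    refine AntitoneOn.union_right
      (hanti _ _ fun x hx => ⟨abs_le.2 ⟨hx.1.le, by linarith [hx.2]⟩, hx.2.ne⟩)
      (hanti _ _ fun x hx => ⟨abs_le.2 ⟨by linarith [hx.1], hx.2.le⟩, hx.1.ne'⟩)
      (isGreatest_Icc (by linarith)) (isLeast_Icc hα.le)
  have hconc : ConcaveOn ℝ (Set.Icc (-α) α) h :=
    (hIcc.mono interior_subset).concaveOn_of_deriv (convex_Icc _ _) hdiff.continuous.continuousOn
      hdiff.differentiableOn
  have htan : h b ≤ h a + (deriv f a / f a + γ * a) * (b - a) := by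
    have ha' := abs_le.1 ha
    have hb' := abs_le.1 hb
    rcases lt_trichotomy a b with hab | rfl | hab
    · have := hconc.slope_le_of_hasDerivAt ha' hb' hab (hd a)
      rw [slope_def_field, div_le_iff₀ (by linarith)] at this
      linarith
    · simp
    · have := hconc.le_slope_of_hasDerivAt hb' ha' hab (hd a)
      rw [slope_def_field, le_div_iff₀ (by linarith)] at this
      linarith
  simp only [hh] at htan
  linarith [htan, show γ / 2 * a ^ 2 + γ * a * (b - a) - γ / 2 * b ^ 2 =
    -(γ / 2 * (b - a) ^ 2) by ring]

end IsLink

/-! ### The likelihood and its score -/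

/-- The derivative at `θ` of the log-likelihood of a single observation. -/
noncomputable def score (f : ℝ → ℝ) (θ : ℝ) (y : Fin 2) : ℝ :=
  if y = 1 then deriv f θ / f θ else -(deriv f θ / (1 - f θ))

variable {K : ℕ} {d : Fin K → ℕ} {f : ℝ → ℝ}

/-- Symmetry turns `log (1 - f θ)` into `log (f (-θ))`, so one quadratic bound serves both outcomes.
-/
theorem logLik_le_quadratic (hf : IsLink f) {α : ℝ} (hα : 0 < α) (hγ : 0 < convexity f α)
    {Θ Θ' : Tensor d} (hΘ : ∀ i, |Θ i| ≤ α) (hΘ' : ∀ i, |Θ' i| ≤ α) (y : BinTensor d) :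
    logLik f y Θ' ≤ logLik f y Θ + ∑ i, score f (Θ i) (y i) * (Θ' - Θ) i -
      convexity f α / 2 * ∑ i, (Θ' - Θ) i ^ 2 := by
  rw [logLik, logLik, Finset.mul_sum, ← Finset.sum_add_distrib, ← Finset.sum_sub_distrib]
  refine Finset.sum_le_sum fun i _ => ?_
  rw [Pi.sub_apply, score]
  rcases (show y i = 0 ∨ y i = 1 by omega) with h | h
  · have := hf.log_le_quadratic hα hγ (a := -Θ i) (b := -Θ' i) (by simpa using hΘ i)
      (by simpa using hΘ' i)
    rw [hf.symm, hf.symm, hf.deriv_neg] at this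
    simp only [h]
    norm_num
    linarith
  · have := hf.log_le_quadratic hα hγ (hΘ i) (hΘ' i)
    simp only [h]
    norm_num
    linarith

lemma continuous_logLik (hf : IsLink f) (y : BinTensor d) : Continuous (logLik f y) := by
  have hc := hf.differentiable.continuous
  unfold logLik
  refine continuous_finsetSum _ fun i _ => ?_
  refine Continuous.add ?_ ?_
  · split_ifs
    · exact (hc.comp (continuous_apply i)).log fun Θ => (hf.pos _).ne'
    · exact continuous_const
  · split_ifs
    · exact (continuous_const.sub (hc.comp (continuous_apply i))).log
        fun Θ => (sub_pos.2 (hf.lt_one _)).ne'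
    · exact continuous_const

/-! ### Concentration of the score -/

lemma _root_.ProbabilityTheory.HasSubgaussianMGF.mono {Ω : Type*} {mΩ : MeasurableSpace Ω}
    {μ : Measure Ω} {X : Ω → ℝ} {c c' : NNReal} (h : HasSubgaussianMGF X c μ) (hc : c ≤ c') :
    HasSubgaussianMGF X c' μ where
  integrable_exp_mul := h.integrable_exp_mul
  mgf_le t := (h.mgf_le t).trans (by gcongr)

section Concentration

variable {K : ℕ} {d : Fin K → ℕ} {f : ℝ → ℝ} {Ω : Type*} [MeasurableSpace Ω] {μ : Measure Ω}
  [IsProbabilityMeasure μ] {Θ : Tensor d} {Y : Ω → BinTensor d}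

lemma integral_score (hf : IsLink f) (hY : IsBernoulliModel f Θ μ Y) (i : Index d) :
    ∫ ω, score f (Θ i) (Y ω i) ∂μ = 0 := by
  have hA : MeasurableSet {ω | Y ω i = 1} := hY.measurable i (measurableSet_singleton 1)
  have hreal : μ.real {ω | Y ω i = 1} = f (Θ i) := by
    rw [measureReal_def, hY.prob, ENNReal.toReal_ofReal (hf.pos _).le]
  have h : (fun ω => score f (Θ i) (Y ω i)) = fun ω =>
      {ω | Y ω i = 1}.indicator
        (fun _ => deriv f (Θ i) / f (Θ i) + deriv f (Θ i) / (1 - f (Θ i))) ω -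
        deriv f (Θ i) / (1 - f (Θ i)) := by
    funext ω
    by_cases hω : Y ω i = 1 <;> simp [score, hω]
  rw [h, integral_sub ((integrable_const _).indicator hA) (integrable_const _),
    integral_indicator_const _ hA, hreal]
  have h1 := (hf.pos (Θ i)).ne'
  have h2 := (sub_pos.2 (hf.lt_one (Θ i))).ne'
  simp only [smul_eq_mul, integral_const, probReal_univ, one_mul]
  field_simp
  ring

/-- Hoeffding's lemma: the two values `f'/f` and `-f'/(1 - f)` differ by `f'/(f(1 - f)) ≤ L_α`. -/
lemma hasSubgaussianMGF_score (hf : IsLink f) (hY : IsBernoulliModel f Θ μ Y) {α : ℝ}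
    (i : Index d) (hΘ : |Θ i| ≤ α) :
    HasSubgaussianMGF (fun ω => score f (Θ i) (Y ω i)) ((‖steepness f α‖₊ / 2) ^ 2) μ := by
  have h0 := hf.pos (Θ i)
  have h1 := sub_pos.2 (hf.lt_one (Θ i))
  have hd := hf.deriv_nonneg (Θ i)
  have hp := div_nonneg hd h0.le
  have hq := div_nonneg hd h1.le
  have hm : Measurable fun ω => score f (Θ i) (Y ω i) :=
    (measurable_of_countable (score f (Θ i))).comp (hY.measurable i)
  refine (hasSubgaussianMGF_of_mem_Icc_of_integral_eq_zero
    (a := -(deriv f (Θ i) / (1 - f (Θ i)))) (b := deriv f (Θ i) / f (Θ i))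
    hm.aemeasurable (Filter.Eventually.of_forall fun ω => ?_) (integral_score hf hY i)).mono ?_
  · unfold score
    split_ifs
    · exact ⟨by linarith, le_rfl⟩
    · exact ⟨le_rfl, by linarith⟩
  · have hsum : deriv f (Θ i) / f (Θ i) - -(deriv f (Θ i) / (1 - f (Θ i))) =
        deriv f (Θ i) / (f (Θ i) * (1 - f (Θ i))) := by
      field_simp
      ring
    gcongr
    rw [← NNReal.coe_le_coe, coe_nnnorm, coe_nnnorm, Real.norm_eq_abs, Real.norm_eq_abs]
    refine abs_le_abs_of_nonneg (by linarith) ?_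
    rw [hsum]
    exact hf.le_steepness hΘ

lemma measureReal_sum_score_ge_le (hf : IsLink f) (hY : IsBernoulliModel f Θ μ Y) {α : ℝ}
    (hΘ : ∀ i, |Θ i| ≤ α) (w : Tensor d) {B : ℝ} (hB : ∑ i, w i ^ 2 ≤ B) {t : ℝ} (ht : 0 ≤ t) :
    μ.real {ω | t ≤ ∑ i, score f (Θ i) (Y ω i) * w i} ≤
      Real.exp (-(2 * t ^ 2 / (steepness f α ^ 2 * B))) := by
  have hB0 : 0 ≤ B := (Finset.sum_nonneg fun i _ => sq_nonneg (w i)).trans hB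
  have hind : iIndepFun (fun i ω => w i * score f (Θ i) (Y ω i)) μ :=
    hY.indep.comp (fun i y => w i * score f (Θ i) y) fun i => measurable_of_countable _
  have hsum := HasSubgaussianMGF.sum_of_iIndepFun hind (s := Finset.univ)
    fun i _ => (hasSubgaussianMGF_score hf hY i (hΘ i)).const_mul (w i)
  have hle : ∑ i, NNReal.mk (w i ^ 2) (sq_nonneg _) * (‖steepness f α‖₊ / 2) ^ 2 ≤
      NNReal.mk B hB0 * (‖steepness f α‖₊ / 2) ^ 2 := by
    rw [← Finset.sum_mul]
    gcongr
    rw [← NNReal.coe_le_coe]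
    simpa using hB
  have h := (hsum.mono hle).measure_ge_le ht
  simp only [mul_comm (w _)] at h
  refine h.trans_eq ?_
  congr 1
  simp only [NNReal.coe_mul, NNReal.coe_mk, NNReal.coe_pow, NNReal.coe_div, coe_nnnorm,
    Real.norm_eq_abs, NNReal.coe_ofNat, div_pow, sq_abs]
  field_simp

lemma sum_outer_sq (v : (k : Fin K) → Fin (d k) → ℝ) :
    ∑ i, outer v i ^ 2 = ∏ k, ∑ j, v k j ^ 2 := by
  rw [Finset.prod_univ_sum, Fintype.piFinset_univ]
  refine Finset.sum_congr rfl fun i _ => ?_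
  rw [outer, Finset.prod_pow]

/-- Union bound for the score over all outer products of test vectors. -/
lemma measureReal_exists_score_ge_le (hf : IsLink f) (hY : IsBernoulliModel f Θ μ Y) {α : ℝ}
    (hΘ : ∀ i, |Θ i| ≤ α) (s : (k : Fin K) → Finset (Fin (d k) → ℝ))
    (hcard : ∀ k, (s k).card ≤ 5 ^ d k) (hs : ∀ k, ∀ c ∈ s k, ∑ j, c j ^ 2 ≤ 4)
    {t : ℝ} (ht : 0 ≤ t) :
    μ.real {ω | ∀ v : (k : Fin K) → Fin (d k) → ℝ, (∀ k, v k ∈ s k) →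
        ∑ i, score f (Θ i) (Y ω i) * outer v i ≤ t}ᶜ ≤
      5 ^ (∑ k, d k) * Real.exp (-(2 * t ^ 2 / (steepness f α ^ 2 * 4 ^ K))) := by
  have hsub : {ω | ∀ v : (k : Fin K) → Fin (d k) → ℝ, (∀ k, v k ∈ s k) →
        ∑ i, score f (Θ i) (Y ω i) * outer v i ≤ t}ᶜ ⊆
      ⋃ v ∈ Fintype.piFinset s, {ω | t ≤ ∑ i, score f (Θ i) (Y ω i) * outer v i} := by
    intro ω hω
    simp only [Set.mem_compl_iff, Set.mem_ofPred_eq, not_forall, not_le] at hω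
    obtain ⟨v, hv, hlt⟩ := hω
    exact Set.mem_biUnion (Fintype.mem_piFinset.2 hv) hlt.le
  refine (measureReal_mono hsub (measure_ne_top _ _)).trans ((measureReal_biUnion_finset_le _ _).trans ?_)
  refine (Finset.sum_le_card_nsmul _ _
    (Real.exp (-(2 * t ^ 2 / (steepness f α ^ 2 * 4 ^ K)))) fun v hv => ?_).trans ?_
  · refine measureReal_sum_score_ge_le hf hY hΘ _ ?_ ht
    rw [sum_outer_sq]
    refine (Finset.prod_le_prod (fun k _ => Finset.sum_nonneg fun j _ => sq_nonneg _)
      fun k _ => hs k _ (Fintype.mem_piFinset.1 hv k)).trans ?_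
    simp
  · rw [nsmul_eq_mul, Fintype.card_piFinset, ← Finset.prod_pow_eq_pow_sum]
    gcongr
    push_cast
    exact Finset.prod_le_prod (fun k _ => by positivity) fun k _ => by exact_mod_cast hcard k

end Concentration

/-! ### The estimation error -/

section Error

variable {K : ℕ} {d : Fin K → ℕ}

lemma abs_le_maxNorm (Θ : Tensor d) (i : Index d) : |Θ i| ≤ maxNorm Θ :=
  le_ciSup (f := fun i => |Θ i|) (Set.finite_range _).bddAbove i

lemma prod_dim_pos (hd : ∀ k, 1 ≤ d k) : 0 < ∏ k, (d k : ℝ) :=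
  Finset.prod_pos fun k _ => by exact_mod_cast hd k

lemma loss_le_two_mul (hd : ∀ k, 1 ≤ d k) {α : ℝ} {Θ Θ' : Tensor d}
    (hΘ : ∀ i, |Θ i| ≤ α) (hΘ' : ∀ i, |Θ' i| ≤ α) (hα : 0 ≤ α) : loss Θ' Θ ≤ 2 * α := by
  have hP := prod_dim_pos hd
  have hcard : (Fintype.card (Index d) : ℝ) = ∏ k, (d k : ℝ) := by
    simp [Index, Fintype.card_pi]
  have hle : frobNorm (Θ' - Θ) ≤ 2 * α * √(∏ k, (d k : ℝ)) := by
    rw [frobNorm, Real.sqrt_le_left (by positivity), mul_pow, Real.sq_sqrt hP.le, ← hcard]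
    refine (Finset.sum_le_card_nsmul _ _ ((2 * α) ^ 2) fun i _ => ?_).trans_eq (by
      simp [mul_comm])
    rw [Pi.sub_apply]
    refine sq_le_sq' ?_ ?_ <;> linarith [abs_le.1 (hΘ i), abs_le.1 (hΘ' i)]
  rw [loss, one_div, inv_mul_le_iff₀ (Real.sqrt_pos.2 hP), mul_comm]
  exact hle

lemma exists_sum_outer_of_cpRank {R : ℕ} (hR : 1 ≤ R) {Θ : Tensor d} (h : cpRank Θ = R) :
    ∃ a : Fin R → (k : Fin K) → Fin (d k) → ℝ, Θ = ∑ r, outer (a r) := by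
  subst h
  refine Nat.sInf_mem (s := {R : ℕ | ∃ a : Fin R → (k : Fin K) → Fin (d k) → ℝ,
    Θ = ∑ r, outer (a r)}) (Set.nonempty_iff_ne_empty.2 fun hempty => ?_)
  -- `sInf ∅ = 0`, so positive rank already guarantees a decomposition.
  rw [cpRank, hempty, Nat.sInf_empty] at hR
  omega

lemma exists_sum_outer_sub {R : ℕ} (hR : 1 ≤ R) {Θ Θ' : Tensor d} (h : cpRank Θ = R)
    (h' : cpRank Θ' = R) :
    ∃ (c : Fin (R + R) → ℝ) (a : Fin (R + R) → (k : Fin K) → Fin (d k) → ℝ),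
      ∀ i, (Θ' - Θ) i = ∑ r, c r * outer (a r) i := by
  obtain ⟨a, ha⟩ := exists_sum_outer_of_cpRank hR h
  obtain ⟨a', ha'⟩ := exists_sum_outer_of_cpRank hR h'
  refine ⟨Fin.append (fun _ => 1) (fun _ => -1), Fin.append a' a, fun i => ?_⟩
  rw [Fin.sum_univ_add, Pi.sub_apply, ha, ha']
  simp only [Finset.sum_apply, Fin.append_left, Fin.append_right, one_mul, neg_one_mul,
    Finset.sum_neg_distrib, sub_eq_add_neg]

lemma ofReal_loss_le_errorBound {f : ℝ → ℝ} (hf : IsLink f) {R : ℕ} (hR : 1 ≤ R) {α C : ℝ}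
    (hα : 0 < α) (hC : 0 < C) (hK : 1 ≤ K) (hd : ∀ k, 1 ≤ d k) {Θ Θ' : Tensor d}
    (hΘ : ∀ i, |Θ i| ≤ α) (hΘ' : ∀ i, |Θ' i| ≤ α)
    (h : 0 < convexity f α → frobNorm (Θ' - Θ) ≤ C * steepness f α / convexity f α *
      √((R : ℝ) ^ (K - 1) * ∑ k, (d k : ℝ))) :
    ENNReal.ofReal (loss Θ' Θ) ≤ errorBound d f R α C := by
  have hP := prod_dim_pos hd
  have hL := hf.steepness_pos hα
  have hsum : 0 < ∑ k, (d k : ℝ) :=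
    Finset.sum_pos (fun k _ => by exact_mod_cast hd k) ⟨⟨0, hK⟩, Finset.mem_univ _⟩
  have hR' : (0 : ℝ) < R := by exact_mod_cast hR
  refine le_min (ENNReal.ofReal_le_ofReal (loss_le_two_mul hd hΘ hΘ' hα.le)) ?_
  -- The quotient is `⊤` here, and stays so in the product because both `L_α` and the square root
  -- are nonzero.
  rcases le_or_gt (convexity f α) 0 with hγ | hγ
  · rw [ENNReal.ofReal_of_nonpos hγ, ENNReal.div_zero, ENNReal.top_mul]
    · exact le_top
    · exact (ENNReal.ofReal_pos.2 (Real.sqrt_pos.2 (by positivity))).ne'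
    · exact (ENNReal.ofReal_pos.2 (by positivity)).ne'
  · rw [← ENNReal.ofReal_div_of_pos hγ, ← ENNReal.ofReal_mul (by positivity)]
    refine ENNReal.ofReal_le_ofReal ?_
    rw [loss, Real.sqrt_div (by positivity), mul_div_assoc', le_div_iff₀ (Real.sqrt_pos.2 hP),
      mul_right_comm, one_div, inv_mul_cancel₀ (Real.sqrt_pos.2 hP).ne', one_mul]
    exact h hγ

end Error

/-- On the event that the spectral norm of the score is at most `M`, the likelihood level set has
small Frobenius radius. -/
theorem frobNorm_le_of_score_le {n : ℕ} {d : Fin (n + 1) → ℕ} {f : ℝ → ℝ} (hf : IsLink f) {R : ℕ}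
    (hR : 1 ≤ R) {α : ℝ} (hα : 0 < α) (hγ : 0 < convexity f α) {Θ Θ' : Tensor d}
    (hΘ : ∀ i, |Θ i| ≤ α) (hΘ' : ∀ i, |Θ' i| ≤ α) (hr : cpRank Θ = R) (hr' : cpRank Θ' = R)
    {y : BinTensor d} (hy : logLik f y Θ ≤ logLik f y Θ') {M : ℝ} (hM : 0 ≤ M)
    (hspec : ∀ u : (k : Fin (n + 1)) → Fin (d k) → ℝ,
      ∑ i, score f (Θ i) (y i) * outer u i ≤ M * ∏ k, √(∑ j, u k j ^ 2)) :
    frobNorm (Θ' - Θ) ≤ 2 * (M * √((2 * R : ℝ) ^ n)) / convexity f α := by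
  obtain ⟨c, a, hca⟩ := exists_sum_outer_sub hR hr hr'
  have h1 := sum_mul_le_of_sum_outer d _ M hM hspec c a _ hca
  have h2 := logLik_le_quadratic hf hα hγ hΘ hΘ' y
  have h3 : frobNorm (Θ' - Θ) ^ 2 = ∑ i, (Θ' - Θ) i ^ 2 :=
    Real.sq_sqrt (Finset.sum_nonneg fun i _ => sq_nonneg _)
  have h4 : 0 ≤ frobNorm (Θ' - Θ) := Real.sqrt_nonneg _
  rw [← h3] at h2
  change _ ≤ _ * frobNorm (Θ' - Θ) at h1
  rw [show ((R + R : ℕ) : ℝ) = 2 * R by push_cast; ring] at h1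
  rw [le_div_iff₀ hγ]
  rcases h4.eq_or_lt with h0 | h0
  · rw [← h0, zero_mul]; positivity
  · refine le_of_mul_le_mul_right ?_ h0
    nlinarith

end BinaryTensor

theorem theorem1 :
    ∃ C₁ : ℝ, 0 < C₁ ∧ ∀ K : ℕ, 1 ≤ K → ∃ C₂ : ℝ, 0 < C₂ ∧
      ∀ (d : Fin K → ℕ) (_ : ∀ k, 1 ≤ d k) (f : ℝ → ℝ) (_ : BinaryTensor.IsLink f)
        (R : ℕ) (_ : 1 ≤ R) (α : ℝ) (_ : 0 < α)
        (D : Set (BinaryTensor.Tensor d)) (_ : D ⊆ BinaryTensor.paramSet d R α)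
        (_ : IsCompact D) (Θtrue : BinaryTensor.Tensor d) (_ : Θtrue ∈ D)
        (Ω : Type*) (_ : MeasurableSpace Ω) (μ : Measure Ω) (_ : IsProbabilityMeasure μ)
        (Y : Ω → BinaryTensor.BinTensor d) (_ : BinaryTensor.IsBernoulliModel f Θtrue μ Y),
        -- a constrained maximum likelihood estimate exists for every observation
        (∀ y : BinaryTensor.BinTensor d, ∃ Θhat, BinaryTensor.IsMLE f D y Θhat) ∧
        -- the bound for the constrained maximum likelihood estimate
        1 - Real.exp (-C₁ * Real.log K * ∑ k, (d k : ℝ)) ≤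
          μ.real {ω | ∀ Θhat, BinaryTensor.IsMLE f D (Y ω) Θhat →
            ENNReal.ofReal (BinaryTensor.loss Θhat Θtrue) ≤
              BinaryTensor.errorBound d f R α C₂} ∧
        -- the same bound for every estimate in the level set
        1 - Real.exp (-C₁ * Real.log K * ∑ k, (d k : ℝ)) ≤
          μ.real {ω | ∀ Θhat, BinaryTensor.InLevelSet f D Θtrue (Y ω) Θhat →
            ENNReal.ofReal (BinaryTensor.loss Θhat Θtrue) ≤
              BinaryTensor.errorBound d f R α C₂} := by
  -- The leading `2` inverts the `1/2` in `γ/2`, `2^K * √(5K)` comes from the threshold `t`, and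
  -- `√(2^(K-1))` from the `2R` outer products.
  refine ⟨1, one_pos, fun K hK => ⟨2 * (2 ^ K * √(5 * K) * √(2 ^ (K - 1))), ?_, ?_⟩⟩
  · have : (0 : ℝ) < K := by exact_mod_cast hK
    positivity
  intro d hd f hf R hR α hα D hD hDc Θ hΘD Ω _ μ _ Y hY
  refine ⟨fun y => ?_, ?_⟩
  · obtain ⟨Θ', h1, h2⟩ := hDc.exists_isMaxOn ⟨Θ, hΘD⟩
      (BinaryTensor.continuous_logLik hf y).continuousOn
    exact ⟨Θ', h1, h2⟩
  set T : ℝ := ∑ k, (d k : ℝ) with hT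
  have hbound : ∀ Θ' ∈ D, ∀ i, |Θ' i| ≤ α := fun Θ' h i =>
    (BinaryTensor.abs_le_maxNorm Θ' i).trans (hD h).2
  have hL := hf.steepness_pos hα
  have hK1 : (1 : ℝ) ≤ K := by exact_mod_cast hK
  have hT0 : 0 ≤ T := Finset.sum_nonneg fun k _ => Nat.cast_nonneg _
  choose s hcard hs hnet using fun k => BinaryTensor.exists_testVectors (d k)
  -- Chosen so that the Hoeffding exponent is `10 * K * T`, which absorbs both `log 5 * T` from the
  -- union bound and `log K * T`.
  set t : ℝ := 2 ^ K * BinaryTensor.steepness f α * √(5 * K * T) with ht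
  have ht0 : 0 ≤ t := by positivity
  set G : Set Ω := {ω | ∀ v : (k : Fin K) → Fin (d k) → ℝ, (∀ k, v k ∈ s k) →
    ∑ i, BinaryTensor.score f (Θ i) (Y ω i) * BinaryTensor.outer v i ≤ t} with hG
  have hGc : μ.real Gᶜ ≤ Real.exp (-1 * Real.log K * T) := by
    refine (BinaryTensor.measureReal_exists_score_ge_le hf hY (hbound Θ hΘD) s hcard hs ht0).trans ?_
    have h1 : 2 * t ^ 2 / (BinaryTensor.steepness f α ^ 2 * 4 ^ K) = 10 * K * T := by
      rw [ht, mul_pow, Real.sq_sqrt (by positivity), mul_pow, ← pow_mul, mul_comm K 2, pow_mul]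
      norm_num
      field_simp
      ring
    have h2 : (5 : ℝ) ^ (∑ k, d k) = Real.exp (Real.log 5 * T) := by
      rw [Real.exp_mul, Real.exp_log (by norm_num), hT, ← Nat.cast_sum, Real.rpow_natCast]
    rw [h1, h2, ← Real.exp_add]
    refine Real.exp_le_exp.2 ?_
    have h3 : Real.log 5 ≤ 5 - 1 := Real.log_le_sub_one_of_pos (by norm_num)
    have h4 : Real.log K ≤ K - 1 := Real.log_le_sub_one_of_pos (by linarith)
    nlinarith [mul_nonneg (show 0 ≤ 10 * (K : ℝ) - Real.log 5 - Real.log K by linarith) hT0]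
  have hGreal : 1 - Real.exp (-1 * Real.log K * T) ≤ μ.real G := by
    -- Subadditivity avoids measurability of `G`.
    have h := measureReal_union_le (μ := μ) G Gᶜ
    rw [Set.union_compl_self, probReal_univ] at h
    linarith
  have hlevel : ∀ ω ∈ G, ∀ Θ', BinaryTensor.InLevelSet f D Θ (Y ω) Θ' →
      ENNReal.ofReal (BinaryTensor.loss Θ' Θ) ≤
        BinaryTensor.errorBound d f R α (2 * (2 ^ K * √(5 * K) * √(2 ^ (K - 1)))) := by
    intro ω hω Θ' hΘ'
    refine BinaryTensor.ofReal_loss_le_errorBound hf hR hα (by positivity) hK hd (hbound Θ hΘD)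
      (hbound Θ' hΘ'.1) fun hγ => ?_
    have hspec := BinaryTensor.sum_mul_outer_le_of_testVectors d s hnet
      (fun i => BinaryTensor.score f (Θ i) (Y ω i)) t hω
    obtain ⟨n, rfl⟩ : ∃ n, K = n + 1 := ⟨K - 1, by omega⟩
    refine (BinaryTensor.frobNorm_le_of_score_le hf hR hα hγ (hbound Θ hΘD) (hbound Θ' hΘ'.1)
      (hD hΘD).1 (hD hΘ'.1).1 hΘ'.2 ht0 hspec).trans_eq ?_
    rw [ht, Nat.add_sub_cancel, mul_pow, Real.sqrt_mul (by positivity) T,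
      Real.sqrt_mul (show (0 : ℝ) ≤ 2 ^ n by positivity),
      Real.sqrt_mul (show (0 : ℝ) ≤ (R : ℝ) ^ n by positivity)]
    ring
  refine ⟨hGreal.trans (measureReal_mono fun ω hω Θ' hΘ' => ?_),
    hGreal.trans (measureReal_mono fun ω hω Θ' hΘ' => hlevel ω hω Θ' hΘ')⟩
  -- A maximiser over `D` lies in the level set because the truth is in `D`.
  exact hlevel ω hω Θ' ⟨hΘ'.1, hΘ'.2 Θ hΘD⟩
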